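/- All graphs are finite and simple. A graph \(H\) is a minor of a graph \(G\) if a graph isomorphic to \(H\) can be obtained from \(G\) by repeatedly deleting vertices, deleting edges and contracting edges. For real \(m\), a graph \(G\) is \(m\)-minor-universal if every graph with at most \(m\) edges and no isolated vertices is a minor of \(G\). The product \(\times\) is the Cartesian (box) product of graphs, in which two tuples are adjacent if they are adjacent in one coordinate and equal in all the others, and \(C_\ell\) is the cycle with \(\ell\) vertices. Theorem B. (1) Let \(k\) and \(n\ge 1\) be natural numbers, let \(G_1,\dots,G_n\) be connected graphs, each with at most \(k\) vertices, let \(H_4\) be any connected graph with \(4\) vertices and \(H_k\) any connected graph with \(k\) vertices. Then the graph \[ H_4\times C_{6n-2}\times H_k\times G_1\times\cdots\times G_n \] is \(\frac{1}{16}|V(G_1)|\cdots|V(G_n)|\)-minor-universal. (2) For every natural number \(k\ge 2\) there is a constant \(C=C(k)>0\), depending only on \(k\), such that for every \(n\ge 1\) and all graphs \(G_1,\dots,G_n\) (not necessarily connected), each with at most \(k\) vertices, the graph \(G_1\times\cdots\times G_n\) is not \(\frac{Ck^n}{\sqrt n}\)-minor-universal. -/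

import Mathlib

namespace ProductMinors

universe u v

/-- Contraction of the edge `uv` of `G`: the vertices `u` and `v` are identified. The vertex `u`
plays the role of the new vertex (and `v` is dropped), so `u` becomes adjacent to all the other
neighbours of `u` and of `v`. -/
def contractEdge {V : Type u} (G : SimpleGraph V) (u v : V) : SimpleGraph {x : V // x ≠ v} where
  Adj a b := a ≠ b ∧
    (G.Adj a.1 b.1 ∨ (a.1 = u ∧ G.Adj v b.1) ∨ (b.1 = u ∧ G.Adj v a.1))
  symm := ⟨fun _ _ h => ⟨h.1.symm, h.2.elim (fun h => Or.inl h.symm)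
    (fun h => Or.inr h.symm)⟩⟩
  loopless := ⟨fun _ h => h.1 rfl⟩

/-- `IsMinor H G` : the graph `H` is a minor of the graph `G`, i.e. by repeatedly deleting vertices
and edges from `G`, as well as contracting edges, one can obtain a graph isomorphic to `H`. -/
inductive IsMinor {W : Type v} (H : SimpleGraph W) : {V : Type u} → SimpleGraph V → Prop
  | of_iso {V : Type u} {G : SimpleGraph V} (e : G ≃g H) : IsMinor H G
  | delete_vertex {V : Type u} {G : SimpleGraph V} (x : V)
      (h : IsMinor H (G.induce {y | y ≠ x})) : IsMinor H G
  | delete_edge {V : Type u} {G : SimpleGraph V} (e : Sym2 V) (he : e ∈ G.edgeSet)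
      (h : IsMinor H (G.deleteEdges {e})) : IsMinor H G
  | contract_edge {V : Type u} {G : SimpleGraph V} (x y : V) (hxy : G.Adj x y)
      (h : IsMinor H (contractEdge G x y)) : IsMinor H G

/-- `G` is `m`-minor-universal: every finite graph with at most `m` edges and with no isolated
vertices is a minor of `G`. (Up to isomorphism every finite graph lives in `Type`.) -/
def IsMinorUniversal {V : Type u} (G : SimpleGraph V) (m : ℝ) : Prop :=
  ∀ (W : Type) [Finite W] (H : SimpleGraph W),
    (∀ w : W, ∃ w' : W, H.Adj w w') → (H.edgeSet.ncard : ℝ) ≤ m → IsMinor H G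

/-- The Cartesian product `G₁ × ⋯ × Gₙ` of a family of graphs: two tuples are adjacent if they are
adjacent in one coordinate and agree in all the others. -/
def boxPi {ι : Type v} {V : ι → Type u} (G : ∀ i, SimpleGraph (V i)) :
    SimpleGraph (∀ i, V i) where
  Adj x y := ∃ i, (G i).Adj (x i) (y i) ∧ ∀ j, j ≠ i → x j = y j
  symm := ⟨fun _ _ ⟨i, h, h'⟩ => ⟨i, h.symm, fun j hj => (h' j hj).symm⟩⟩
  loopless := ⟨fun _ ⟨i, h, _⟩ => (G i).loopless.irrefl _ h⟩

end ProductMinors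

/-! ### Minors described by connected branch sets -/

namespace ProductMinors

universe u v w

open Relation

/-! Minors are handled as partial labellings whose fibres are the branch sets (`IsModel.isMinor`,
`IsMinor.exists_isModel`).

Universality. Let X be the vertex set of G₁ × ⋯ × Gₙ. By König's edge colouring theorem, every
permutation of X is a product of 2n - 1 permutations that each change one coordinate
(`exists_prod_eq_of_forall_notMem`). Three copies of Hₖ × G₁ × ⋯ × Gₙ realise such a factor by
disjoint connected sets: lift x to a height in Hₖ that encodes its i-th coordinate, move freely
along direction i, where tuples on a common line are now kept apart by their heights, and return to
the base height (`routable_of_changesOnly`). With one idle layer this takes 3(2n - 1) + 1 = 6n - 2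
layers. Closing the layers into a cycle joins the end of the route of x to the start of the route of
σ x, so each orbit of σ becomes one connected set. As the orbits can be any partition of X, any
classes of positions can be merged simultaneously (`Routable.exists_merged`). Two adjacent vertices
of H₄ give two such merged copies: place the darts of H on distinct positions, merge them by tail in
one copy and by underlying edge in the other; the rungs between the copies yield H
(`exists_isModel_of_merge`).

Non-universality. Inject each factor into {0, …, k - 1} and let the level of a tuple be its number
of zeros. Adjacent tuples differ by at most one level, and a Fourier estimate bounds every level by
O(kⁿ/√n) (`card_level_le`). Levels are thus small separators, while a random sparse graph on M
vertices, with O(M) edges, joins any two disjoint sets of at least M/4 vertices. For M a suitable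
multiple of the level bound it cannot be a minor (`not_isMinor_of_levels`). -/

/-- The nonempty fibres of a partial labelling `f` of the vertices of `G` are connected in `G`. -/
def FiberConnected {V : Type u} {W : Type v} (G : SimpleGraph V) (f : V → Option W) : Prop :=
  ∀ w x y, f x = some w → f y = some w →
    ReflTransGen (fun a b => G.Adj a b ∧ f a = some w ∧ f b = some w) x y

/-- The fibres of the partial labelling `f` of the vertices of `G` are the branch sets of a model
of the minor `H`. -/
structure IsModel {V : Type u} {W : Type v} (H : SimpleGraph W) (G : SimpleGraph V)
    (f : V → Option W) : Prop where
  surj : ∀ w, ∃ x, f x = some w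
  conn : FiberConnected G f
  adj : ∀ w w', H.Adj w w' → ∃ x y, f x = some w ∧ f y = some w' ∧ G.Adj x y

section Contraction

variable {V : Type u} {W : Type v}

open Classical in
/-- The projection of the vertices of `G` to those of the contraction of the edge `xy`. -/
noncomputable def contractMap {x y : V} (hxy : x ≠ y) (z : V) : {z : V // z ≠ y} :=
  if h : z = y then ⟨x, hxy⟩ else ⟨z, h⟩

theorem contractMap_self {x y : V} (hxy : x ≠ y) : contractMap hxy y = ⟨x, hxy⟩ := by
  simp [contractMap]

theorem contractMap_of_ne {x y z : V} (hxy : x ≠ y) (h : z ≠ y) : contractMap hxy z = ⟨z, h⟩ := by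
  simp [contractMap, h]

theorem contractMap_coe {x y : V} (hxy : x ≠ y) (z : {z : V // z ≠ y}) :
    contractMap hxy z = z := contractMap_of_ne hxy z.2

theorem contractEdge_adj_contractMap {G : SimpleGraph V} {x y a b : V} (hxy : x ≠ y)
    (h : G.Adj a b) (hne : contractMap hxy a ≠ contractMap hxy b) :
    (contractEdge G x y).Adj (contractMap hxy a) (contractMap hxy b) := by
  refine ⟨hne, ?_⟩
  by_cases ha : a = y <;> by_cases hb : b = y
  · subst ha; subst hb; exact absurd h (G.loopless.irrefl _)
  · subst ha
    rw [contractMap_self, contractMap_of_ne hxy hb]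
    exact Or.inr (Or.inl ⟨rfl, h⟩)
  · subst hb
    rw [contractMap_self, contractMap_of_ne hxy ha]
    exact Or.inr (Or.inr ⟨rfl, h.symm⟩)
  · rw [contractMap_of_ne hxy ha, contractMap_of_ne hxy hb]
    exact Or.inl h

theorem apply_contractMap {f : V → Option W} {x y : V} (hxy : x ≠ y) (hf : f x = f y) (z : V) :
    f (contractMap hxy z) = f z := by
  by_cases h : z = y
  · subst h; rw [contractMap_self]; exact hf
  · rw [contractMap_of_ne hxy h]

theorem IsModel.contract {H : SimpleGraph W} {G : SimpleGraph V} {f : V → Option W}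
    (h : IsModel H G f) {x y : V} (hxy : x ≠ y) (hf : f x = f y) :
    IsModel H (contractEdge G x y) (fun z => f z) := by
  refine ⟨fun w => ?_, fun w a b ha hb => ?_, fun w w' hw => ?_⟩
  · obtain ⟨z, hz⟩ := h.surj w
    exact ⟨contractMap hxy z, by rw [apply_contractMap hxy hf, hz]⟩
  · have := h.conn w a b ha hb
    have key := ReflTransGen.lift' (p := fun a b : {z : V // z ≠ y} =>
      (contractEdge G x y).Adj a b ∧ f a = some w ∧ f b = some w) (contractMap hxy) ?_ _ _ this
    · rwa [Function.onFun, contractMap_coe, contractMap_coe] at key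
    · rintro a b ⟨hab, ha, hb⟩
      by_cases hne : contractMap hxy a = contractMap hxy b
      · rw [Function.onFun, hne]
      · exact ReflTransGen.single ⟨contractEdge_adj_contractMap hxy hab hne, by
          rw [apply_contractMap hxy hf, ha], by rw [apply_contractMap hxy hf, hb]⟩
  · obtain ⟨a, b, ha, hb, hab⟩ := h.adj w w' hw
    have ha' := (apply_contractMap hxy hf a).trans ha
    have hb' := (apply_contractMap hxy hf b).trans hb
    refine ⟨contractMap hxy a, contractMap hxy b, ha', hb',
      contractEdge_adj_contractMap hxy hab fun hne => ?_⟩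
    rw [hne, hb'] at ha'
    exact hw.ne (Option.some.inj ha').symm

theorem IsModel.of_contract {H : SimpleGraph W} {G : SimpleGraph V} {x y : V} (hxy : G.Adj x y)
    {f : {z : V // z ≠ y} → Option W} (h : IsModel H (contractEdge G x y) f) :
    IsModel H G (fun z => f (contractMap hxy.ne z)) := by
  have step : ∀ w (a b : {z : V // z ≠ y}), (contractEdge G x y).Adj a b → f a = some w →
      f b = some w → ReflTransGen (fun a b => G.Adj a b ∧ f (contractMap hxy.ne a) = some w ∧
        f (contractMap hxy.ne b) = some w) a.1 b.1 := by
    rintro w ⟨a, ha⟩ ⟨b, hb⟩ ⟨-, hab⟩ hfa hfb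
    simp only at hab ⊢
    have hfa' : f (contractMap hxy.ne a) = some w := by rw [contractMap_of_ne _ ha, hfa]
    have hfb' : f (contractMap hxy.ne b) = some w := by rw [contractMap_of_ne _ hb, hfb]
    rcases hab with hab | ⟨rfl, hab⟩ | ⟨rfl, hab⟩
    · exact .single ⟨hab, hfa', hfb'⟩
    · have hy : f (contractMap hxy.ne y) = some w := by rw [contractMap_self, hfa]
      exact (ReflTransGen.single ⟨hxy, hfa', hy⟩).tail ⟨hab, hy, hfb'⟩
    · have hy : f (contractMap hxy.ne y) = some w := by rw [contractMap_self, hfb]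
      exact (ReflTransGen.single ⟨hab.symm, hfa', hy⟩).tail ⟨hxy.symm, hy, hfb'⟩
  have proj : ∀ w a, f (contractMap hxy.ne a) = some w →
      ReflTransGen (fun a b => G.Adj a b ∧ f (contractMap hxy.ne a) = some w ∧
        f (contractMap hxy.ne b) = some w) a (contractMap hxy.ne a).1 ∧
      ReflTransGen (fun a b => G.Adj a b ∧ f (contractMap hxy.ne a) = some w ∧
        f (contractMap hxy.ne b) = some w) (contractMap hxy.ne a).1 a := by
    intro w a ha
    by_cases h : a = y
    · subst h
      have hx : f (contractMap hxy.ne x) = some w := by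
        rw [contractMap_of_ne _ hxy.ne, ← ha, contractMap_self]
      have e : (contractMap hxy.ne a).1 = x := by rw [contractMap_self]
      rw [e]
      exact ⟨.single ⟨hxy.symm, ha, hx⟩, .single ⟨hxy, hx, ha⟩⟩
    · have e : (contractMap hxy.ne a).1 = a := by rw [contractMap_of_ne _ h]
      rw [e]
      exact ⟨.refl, .refl⟩
  refine ⟨fun w => ?_, fun w a b ha hb => ?_, fun w w' hw => ?_⟩
  · obtain ⟨z, hz⟩ := h.surj w
    exact ⟨z, by rw [contractMap_coe, hz]⟩
  · refine (proj w a ha).1.trans (ReflTransGen.trans ?_ (proj w b hb).2)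
    exact ReflTransGen.lift' Subtype.val (fun a b hab => step w a b hab.1 hab.2.1 hab.2.2)
      _ _ (h.conn w _ _ ha hb)
  · obtain ⟨⟨a, hay⟩, ⟨b, hby⟩, ha, hb, -, hab⟩ := h.adj w w' hw
    have ha' : f (contractMap hxy.ne a) = some w := by rw [contractMap_of_ne _ hay, ha]
    have hb' : f (contractMap hxy.ne b) = some w' := by rw [contractMap_of_ne _ hby, hb]
    simp only at hab
    rcases hab with hab | ⟨rfl, hab⟩ | ⟨rfl, hab⟩
    · exact ⟨a, b, ha', hb', hab⟩
    · exact ⟨y, b, by rw [contractMap_self, ha], hb', hab⟩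
    · exact ⟨a, y, ha', by rw [contractMap_self, hb], hab.symm⟩

end Contraction

theorem FiberConnected.exists_adj {V : Type u} {W : Type v} {G : SimpleGraph V} {f : V → Option W}
    (h : FiberConnected G f) {x y : V} {w : W} (hx : f x = some w) (hy : f y = some w)
    (hne : x ≠ y) : ∃ z, G.Adj x z ∧ f z = some w := by
  rcases ReflTransGen.cases_head (h w x y hx hy) with rfl | ⟨z, hz, -⟩
  · exact absurd rfl hne
  · exact ⟨z, hz.1, hz.2.2⟩

theorem isMinor_of_equiv {V : Type u} {W : Type v} [Finite V] {H : SimpleGraph W}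
    {G : SimpleGraph V} (e : V ≃ W) (h : ∀ x y, H.Adj (e x) (e y) → G.Adj x y) : IsMinor H G := by
  induction hm : G.edgeSet.ncard using Nat.strong_induction_on generalizing G with
  | _ m ih =>
    by_cases hG : ∀ x y, G.Adj x y → H.Adj (e x) (e y)
    · exact .of_iso ⟨e, fun {x y} => ⟨h x y, hG x y⟩⟩
    · push Not at hG
      obtain ⟨x, y, hxy, hn⟩ := hG
      refine .delete_edge s(x, y) hxy (ih _ ?_ (fun a b hab => ?_) rfl)
      · rw [SimpleGraph.edgeSet_deleteEdges, ← hm]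
        exact Set.ncard_sdiff_singleton_lt_of_mem hxy
      · rw [SimpleGraph.deleteEdges_adj]
        refine ⟨h a b hab, fun hs => ?_⟩
        rcases Sym2.eq_iff.1 (Set.mem_singleton_iff.1 hs) with ⟨rfl, rfl⟩ | ⟨rfl, rfl⟩
        · exact hn hab
        · exact hn hab.symm

/-- Induction on the number of vertices: delete an unlabelled vertex; otherwise, if two vertices
share a label, connectivity provides an edge inside that fibre to contract; otherwise the labelling
is a bijection and only surplus edges remain. -/
theorem IsModel.isMinor {V : Type u} {W : Type v} [Finite V] {H : SimpleGraph W}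
    {G : SimpleGraph V} {f : V → Option W} (h : IsModel H G f) : IsMinor H G := by
  induction hm : Nat.card V using Nat.strong_induction_on generalizing V with
  | _ m ih =>
    have hlt : ∀ y : V, Nat.card {z : V // z ≠ y} < m := fun y => by
      rw [← hm]
      exact Finite.card_subtype_lt (x := y) (by simp)
    by_cases h0 : ∃ x, f x = none
    · obtain ⟨x, hx⟩ := h0
      have hne : ∀ {z w}, f z = some w → z ∈ {y | y ≠ x} := fun {z w} hz h => by
        rw [h, hx] at hz; exact absurd hz (by simp)
      refine .delete_vertex x (ih _ (hlt x) (f := fun z => f z.1)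
        ⟨fun w => ?_, fun w a b ha hb => ?_, fun w w' hw => ?_⟩ rfl)
      · obtain ⟨z, hz⟩ := h.surj w
        exact ⟨⟨z, hne hz⟩, hz⟩
      · obtain ⟨a, hax⟩ := a
        obtain ⟨b, hbx⟩ := b
        have := h.conn w a b ha hb
        induction this with
        | refl => exact .refl
        | tail hab hbc ihh =>
          exact (ihh (hne hbc.2.1) hbc.2.1).tail ⟨hbc.1, hbc.2.1, hbc.2.2⟩
      · obtain ⟨a, b, ha, hb, hab⟩ := h.adj w w' hw
        exact ⟨⟨a, hne ha⟩, ⟨b, hne hb⟩, ha, hb, hab⟩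
    · push Not at h0
      choose g hg using fun x => Option.ne_none_iff_exists'.1 (h0 x)
      by_cases hinj : Function.Injective g
      · have hsurj : Function.Surjective g := fun w => by
          obtain ⟨x, hx⟩ := h.surj w
          exact ⟨x, Option.some.inj ((hg x).symm.trans hx)⟩
        refine isMinor_of_equiv (Equiv.ofBijective g ⟨hinj, hsurj⟩) fun x y hxy => ?_
        obtain ⟨a, b, ha, hb, hab⟩ := h.adj _ _ hxy
        rw [hg] at ha hb
        rwa [← hinj (Option.some.inj ha), ← hinj (Option.some.inj hb)]
      · simp only [Function.Injective, not_forall] at hinj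
        obtain ⟨x, y, hxy, hne⟩ := hinj
        obtain ⟨z, hz, hfz⟩ := h.conn.exists_adj (hg x) (hxy ▸ hg y) hne
        exact .contract_edge x z hz (ih _ (hlt z) (h.contract hz.ne ((hg x).trans hfz.symm)) rfl)

theorem IsMinor.exists_isModel {V : Type u} {W : Type v} {H : SimpleGraph W}
    {G : SimpleGraph V} (h : IsMinor H G) : ∃ f, IsModel H G f := by
  induction h with
  | of_iso e =>
    refine ⟨fun x => some (e x), fun w => ⟨e.symm w, by simp⟩, fun w x y hx hy => ?_,
      fun w w' hw => ⟨e.symm w, e.symm w', by simp, by simp, by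
        simpa [← e.map_adj_iff] using hw⟩⟩
    rw [e.injective (Option.some.inj (hx.trans hy.symm))]
  | @delete_vertex V G x _ ih =>
    classical
    obtain ⟨f, hf⟩ := ih
    let g : V → Option W := fun z => if h : z = x then none else f ⟨z, h⟩
    have hg : ∀ z : {y | y ≠ x}, g z = f z := fun z => dif_neg z.2
    have hg' : ∀ {z w}, g z = some w → z ≠ x := fun {z w} h hz => by
      simp [g, hz] at h
    refine ⟨g, fun w => ?_, fun w a b ha hb => ?_, fun w w' hw => ?_⟩
    · obtain ⟨z, hz⟩ := hf.surj w
      exact ⟨z, (hg z).trans hz⟩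
    · refine ReflTransGen.lift (Subtype.val : {y | y ≠ x} → V) (fun a b hab => ?_)
        _ _ (hf.conn w ⟨a, hg' ha⟩ ⟨b, hg' hb⟩ ((hg _).symm.trans ha) ((hg _).symm.trans hb))
      exact ⟨hab.1, (hg _).trans hab.2.1, (hg _).trans hab.2.2⟩
    · obtain ⟨a, b, ha, hb, hab⟩ := hf.adj w w' hw
      exact ⟨a, b, (hg a).trans ha, (hg b).trans hb, hab⟩
  | delete_edge e he _ ih =>
    obtain ⟨f, hf⟩ := ih
    refine ⟨f, hf.surj, fun w a b ha hb => ?_, fun w w' hw => ?_⟩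
    · exact ReflTransGen.mono (fun a b h => ⟨SimpleGraph.deleteEdges_le _ h.1, h.2⟩) _ _
        (hf.conn w a b ha hb)
    · obtain ⟨a, b, ha, hb, hab⟩ := hf.adj w w' hw
      exact ⟨a, b, ha, hb, SimpleGraph.deleteEdges_le _ hab⟩
  | contract_edge x y hxy _ ih =>
    obtain ⟨f, hf⟩ := ih
    exact ⟨_, hf.of_contract hxy⟩

/-! ### Edge colouring and factorization of permutations of a product -/

section

open Finset

/-- König's edge colouring theorem for a `d`-regular bipartite multigraph, given by a set `F` of
edges and the maps `s` and `t` sending an edge to its two ends. -/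
theorem exists_edge_coloring {E : Type u} {Y : Type v} [DecidableEq E] [Fintype Y]
    [DecidableEq Y] (s t : E → Y) (d : ℕ) (F : Finset E)
    (hs : ∀ y, #{e ∈ F | s e = y} = d) (ht : ∀ y, #{e ∈ F | t e = y} = d) :
    ∃ c : E → ℕ, (∀ e ∈ F, c e < d) ∧
      ∀ e ∈ F, ∀ e' ∈ F, c e = c e' → (s e = s e' ∨ t e = t e') → e = e' := by
  induction d generalizing F with
  | zero =>
    have : F = ∅ := by
      refine eq_empty_of_forall_notMem fun e he => ?_
      have h := card_eq_zero.1 (hs (s e))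
      exact notMem_empty e (h ▸ mem_filter.2 ⟨he, rfl⟩)
    subst this
    exact ⟨fun _ => 0, by simp, by simp⟩
  | succ d ih =>
    -- Hall's condition by double counting: the (d + 1)|A| edges leaving A all end in its
    -- neighbourhood N, which receives exactly (d + 1)|N| edges.
    have hall : ∀ A : Finset Y, #A ≤ #(A.biUnion fun y => image t {e ∈ F | s e = y}) := by
      intro A
      set N := A.biUnion fun y => image t {e ∈ F | s e = y} with hN
      have hfib : ∀ r : E → Y, (∀ y, #{e ∈ F | r e = y} = d + 1) → ∀ B : Finset Y,
          #{e ∈ F | r e ∈ B} = #B * (d + 1) := by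
        intro r hr B
        rw [card_eq_sum_card_fiberwise (s := {e ∈ F | r e ∈ B}) (f := r) (t := B)
          fun e he => (mem_filter.1 (mem_coe.1 he)).2, sum_const_nat]
        intro y hy
        rw [← hr y, filter_filter]
        congr 1
        ext e
        simp only [mem_filter]
        constructor
        · rintro ⟨h, -, h'⟩; exact ⟨h, h'⟩
        · rintro ⟨h, rfl⟩; exact ⟨h, hy, rfl⟩
      have h3 : #{e ∈ F | s e ∈ A} ≤ #{e ∈ F | t e ∈ N} := by
        refine card_le_card fun e he => ?_
        rw [mem_filter] at he ⊢
        refine ⟨he.1, mem_biUnion.2 ⟨s e, he.2, mem_image.2 ⟨e, mem_filter.2 ⟨he.1, rfl⟩, rfl⟩⟩⟩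
      rw [hfib s hs, hfib t ht] at h3
      exact Nat.le_of_mul_le_mul_right h3 d.succ_pos
    obtain ⟨f, hf, hft⟩ := (all_card_le_biUnion_card_iff_exists_injective _).1 hall
    have hfe : ∀ y, ∃ e, (e ∈ F ∧ s e = y) ∧ t e = f y := fun y => by
      obtain ⟨e, he, h⟩ := mem_image.1 (hft y)
      exact ⟨e, mem_filter.1 he, h⟩
    choose m hm hmt using hfe
    have hsurj := Finite.injective_iff_surjective.1 hf
    have key : ∀ (r : E → Y), (∀ y, #{e ∈ F | r e = y} = d + 1) → ∀ y y', r (m y') = y →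
        (∀ z, r (m z) = y → z = y') → #{e ∈ F.filter (fun e => e ≠ m (s e)) | r e = y} = d := by
      intro r hr y y' hy hu
      rw [filter_filter]
      have : ({e ∈ F | e ≠ m (s e) ∧ r e = y} : Finset E) =
          ({e ∈ F | r e = y} : Finset E).erase (m y') := by
        ext e
        simp only [mem_filter, mem_erase]
        constructor
        · rintro ⟨h, h', h''⟩
          refine ⟨?_, h, h''⟩
          rintro rfl
          exact h' (by rw [(hm y').2])
        · rintro ⟨h, h', h''⟩
          refine ⟨h', fun h3 => h ?_, h''⟩
          rw [← hu (s e) (by rw [← h3, h''])]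
          exact h3
      rw [this, card_erase_of_mem (mem_filter.2 ⟨(hm y').1, hy⟩), hr]
      rfl
    obtain ⟨c, hc, hinj⟩ := ih (F.filter fun e => e ≠ m (s e))
      (fun y => key s hs y y (hm y).2 fun z hz => by rw [← hz, (hm z).2])
      (fun y => by
        obtain ⟨y', rfl⟩ := hsurj y
        exact key t ht _ y' (hmt y') fun z hz => hf (by rw [← hmt z, hz]))
    -- The perfect matching `m` receives the new colour d; the remaining d-regular multigraph keeps
    -- its colouring.
    refine ⟨fun e => if e = m (s e) then d else c e, fun e he => ?_, fun e he e' he' hcc h => ?_⟩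
    · beta_reduce
      by_cases h : e = m (s e)
      · rw [if_pos h]; exact d.lt_succ_self
      · rw [if_neg h]; exact (hc e (mem_filter.2 ⟨he, h⟩)).trans d.lt_succ_self
    · simp only at hcc
      by_cases h1 : e = m (s e) <;> by_cases h2 : e' = m (s e')
      · rcases h with h | h
        · rw [h1, h2, h]
        · rw [h1, h2, hmt, hmt] at h
          rw [h1, h2, hf h]
      · rw [if_pos h1, if_neg h2] at hcc
        exact absurd hcc (hc e' (mem_filter.2 ⟨he', h2⟩)).ne'
      · rw [if_neg h1, if_pos h2] at hcc
        exact absurd hcc (hc e (mem_filter.2 ⟨he, h1⟩)).ne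
      · rw [if_neg h1, if_neg h2] at hcc
        exact hinj e (mem_filter.2 ⟨he, h1⟩) e' (mem_filter.2 ⟨he', h2⟩) hcc h

section Product

variable {ι : Type v} {V : ι → Type u}

/-- The map `ρ` changes only the `i`-th coordinate. -/
def ChangesOnly (i : ι) (ρ : (∀ i, V i) → ∀ i, V i) : Prop :=
  ∀ x j, j ≠ i → ρ x j = x j

/-- A permutation of a product is a permutation of one coordinate, followed by a permutation that
fixes this coordinate, followed by a permutation of this coordinate. -/
theorem exists_factorization [Finite ι] [∀ i, Finite (V i)] (i : ι)
    (σ : Equiv.Perm (∀ i, V i)) :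
    ∃ α β γ : Equiv.Perm (∀ i, V i), ChangesOnly i α ∧ ChangesOnly i γ ∧ σ = γ * β * α ∧
      (∀ x, β x i = x i) ∧ ∀ j, j ≠ i → (∀ x, σ x j = x j) → ∀ x, β x j = x j := by
  classical
  have := Fintype.ofFinite ι
  have := fun i => Fintype.ofFinite (V i)
  let r : (∀ i, V i) → ∀ j : {j // j ≠ i}, V j := fun x j => x j
  have hcard : ∀ y, #{x | r x = y} = Fintype.card (V i) := by
    intro y
    symm
    refine Finset.card_bij' (s := univ) (fun a _ => fun j => if h : j = i then h ▸ a else y ⟨j, h⟩)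
      (fun x _ => x i) ?_ ?_ ?_ ?_
    · intro a _
      rw [mem_filter]
      refine ⟨mem_univ _, funext fun j => ?_⟩
      simp [r, j.2]
    · simp
    · simp
    · intro x hx
      rw [mem_filter] at hx
      funext j
      by_cases h : j = i
      · subst h; simp
      · simp [h, ← hx.2, r]
  -- Each x is an edge from its line in direction i to the line of σ x. Its colour, read in `V i`,
  -- serves as the i-th coordinate while the other coordinates are being moved: properness at the
  -- two ends makes `α` and `δ` injective.
  obtain ⟨c, hc, hinj⟩ := exists_edge_coloring r (r ∘ σ) (Fintype.card (V i)) univ hcard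
    (fun y => by
      rw [← hcard y]
      exact card_equiv σ (by simp))
  let c' : (∀ i, V i) → V i := fun x => (Fintype.equivFin (V i)).symm ⟨c x, hc x (mem_univ _)⟩
  have hc' : ∀ x y, c' x = c' y → c x = c y := fun x y h => by
    simpa [c'] using h
  have hα : Function.Injective fun x => Function.update x i (c' x) := by
    intro x y h
    have h1 := congrFun h i
    simp only [Function.update_self] at h1
    refine hinj x (mem_univ _) y (mem_univ _) (hc' _ _ h1) (Or.inl (funext fun j => ?_))
    simpa [j.2] using congrFun h j
  have hγ : Function.Injective fun y => Function.update y i (c' (σ.symm y)) := by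
    intro x y h
    have h1 := congrFun h i
    simp only [Function.update_self] at h1
    refine σ.symm.injective (hinj _ (mem_univ _) _ (mem_univ _) (hc' _ _ h1)
      (Or.inr (funext fun j => ?_)))
    simpa [j.2, r] using congrFun h j
  let α := Equiv.ofBijective _ (Finite.injective_iff_bijective.1 hα)
  let δ := Equiv.ofBijective _ (Finite.injective_iff_bijective.1 hγ)
  have hαx : ∀ x, α x = Function.update x i (c' x) := fun x => rfl
  have hδx : ∀ x, δ x = Function.update x i (c' (σ.symm x)) := fun x => rfl
  have hβ : ∀ x, (δ * σ * α⁻¹) (α x) = Function.update (σ x) i (c' x) := fun x => by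
    simp [hδx]
  refine ⟨α, δ * σ * α⁻¹, δ⁻¹, fun x j hj => by simp [hαx, hj], fun x j hj => ?_, by group,
    fun x => ?_, fun j hj h x => ?_⟩
  · obtain ⟨x, rfl⟩ := δ.surjective x
    rw [Equiv.Perm.inv_def, Equiv.symm_apply_apply, hδx, Function.update_of_ne hj]
  · obtain ⟨x, rfl⟩ := α.surjective x
    rw [hβ]; simp [hαx]
  · obtain ⟨x, rfl⟩ := α.surjective x
    rw [hβ]; simp [hαx, hj, h]

/-- Every permutation of a product that changes only the coordinates in a nonempty set `S` is the
composition of `2 |S| - 1` permutations each of which changes only one coordinate. -/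
theorem exists_prod_eq_of_forall_notMem [Finite ι] [∀ i, Finite (V i)]
    (S : Finset ι) (hS : S.Nonempty) (σ : Equiv.Perm (∀ i, V i))
    (hσ : ∀ j, j ∉ S → ∀ x, σ x j = x j) :
    ∃ l : List (Equiv.Perm (∀ i, V i)), l.length + 1 = 2 * #S ∧ l.prod = σ ∧
      ∀ ρ ∈ l, ∃ i, ChangesOnly i ρ := by
  classical
  induction hS using Finset.Nonempty.cons_induction generalizing σ with
  | singleton i =>
    refine ⟨[σ], by simp, by simp, ?_⟩
    simp only [List.mem_singleton, forall_eq]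
    exact ⟨i, fun x j hj => hσ j (by simpa using hj) x⟩
  | cons i S hi hS ih =>
    obtain ⟨α, β, γ, hα, hγ, rfl, hβi, hβ⟩ := exists_factorization i σ
    obtain ⟨l, hl, hprod, hmem⟩ := ih β fun j hj => by
      by_cases h : j = i
      · subst h; exact hβi
      · exact hβ j h (hσ j (by simp [h, hj]))
    refine ⟨γ :: (l ++ [α]), ?_, by simp [hprod, mul_assoc], ?_⟩
    · simp only [List.length_cons, List.length_append, List.length_nil, card_cons]
      omega
    · simp only [List.mem_cons, List.mem_append, List.not_mem_nil, or_false]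
      rintro ρ (rfl | h | rfl)
      exacts [⟨i, hγ⟩, hmem ρ h, ⟨i, hα⟩]

end Product

/-- Every function on a finite type is the orbit map of some permutation. -/
theorem exists_perm_sameCycle {X : Type u} {Y : Type v} [Finite X] (g : X → Y) :
    ∃ σ : Equiv.Perm X, (∀ x, g (σ x) = g x) ∧
      ∀ x y, g x = g y → ∃ n : ℕ, (σ ^ n) x = y := by
  classical
  have := Fintype.ofFinite X
  choose f hf hf' using fun y => exists_cycleOn ({x | g x = y} : Finset X)
  have hg : ∀ x, g (f (g x) x) = g x := fun x => by
    have := (hf (g x)).1.1 (show x ∈ (({z | g z = g x} : Finset X) : Set X) by simp)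
    simpa using this
  have hinj : Function.Injective fun x => f (g x) x := by
    intro x y h
    have h1 : g x = g y := by rw [← hg x, ← hg y]; exact congrArg g h
    simp only [h1] at h
    exact (f (g y)).injective h
  let σ := Equiv.ofBijective _ (Finite.injective_iff_bijective.1 hinj)
  have hσ : ∀ x, σ x = f (g x) x := fun x => rfl
  have hpow : ∀ (n : ℕ) x, (σ ^ n) x = (f (g x) ^ n) x ∧ g ((σ ^ n) x) = g x := by
    intro n x
    induction n with
    | zero => simp
    | succ n ih =>
      rw [pow_succ', pow_succ', Equiv.Perm.mul_apply, Equiv.Perm.mul_apply]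
      exact ⟨by rw [hσ, ih.2, ih.1], by rw [hσ, hg, ih.2]⟩
  refine ⟨σ, hg, fun x y h => ?_⟩
  obtain ⟨n, -, hn⟩ := (hf (g x)).exists_pow_eq (a := x) (b := y) (by simp) (by simp [h])
  exact ⟨n, by rw [(hpow n x).1, hn]⟩

end

/-! ### Paths inside fibres, and routing through consecutive layers -/

section Fibers

variable {V : Type u} {W : Type v} {G : SimpleGraph V}

theorem FiberConnected.map_equiv {W' : Type w} {f : V → Option W} (h : FiberConnected G f)
    (e : W ≃ W') : FiberConnected G fun x => (f x).map e := by
  have key : ∀ x w, (f x).map e = some w ↔ f x = some (e.symm w) := fun x w => by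
    rw [Option.map_eq_some_iff]
    exact ⟨fun ⟨a, ha, hw⟩ => by rw [ha, ← hw, e.symm_apply_apply], fun h => ⟨_, h, by simp⟩⟩
  intro w x y hx hy
  exact ReflTransGen.mono (fun a b hab => ⟨hab.1, (key a w).2 hab.2.1, (key b w).2 hab.2.2⟩) _ _
    (h (e.symm w) x y ((key x w).1 hx) ((key y w).1 hy))

/-- Two vertices are joined by a path inside the fibre of `w`. -/
abbrev FiberPath (G : SimpleGraph V) (f : V → Option W) (w : W) : V → V → Prop :=
  ReflTransGen fun a b => G.Adj a b ∧ f a = some w ∧ f b = some w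

theorem FiberPath.symm {f : V → Option W} {w : W} {x y : V} (h : FiberPath G f w x y) :
    FiberPath G f w y x := by
  induction h with
  | refl => exact .refl
  | tail _ h ih => exact ReflTransGen.head ⟨h.1.symm, h.2.2, h.2.1⟩ ih

theorem FiberPath.of_adj {f : V → Option W} {w : W} {x y : V} (h : G.Adj x y)
    (hx : f x = some w) (hy : f y = some w) : FiberPath G f w x y := .single ⟨h, hx, hy⟩

/-- Paths in a fibre are mapped to paths in a fibre by a graph homomorphism that respects fibres. -/
theorem FiberPath.map {V' : Type*} {W' : Type*} {G' : SimpleGraph V'} {f : V → Option W}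
    {f' : V' → Option W'} {w : W} {w' : W'} {x y : V} (h : FiberPath G f w x y) (φ : V → V')
    (hφ : ∀ a b, G.Adj a b → G'.Adj (φ a) (φ b)) (hf : ∀ a, f a = some w → f' (φ a) = some w') :
    FiberPath G' f' w' (φ x) (φ y) :=
  ReflTransGen.lift φ (fun a b hab => ⟨hφ a b hab.1, hf a hab.2.1, hf b hab.2.2⟩) _ _ h

theorem FiberPath.of_connected {V' : Type*} {W' : Type*} {G' : SimpleGraph V'}
    {f' : V' → Option W'} {w' : W'} (hG : G.Connected) (φ : V → V')
    (hφ : ∀ a b, G.Adj a b → G'.Adj (φ a) (φ b)) (hf : ∀ a, f' (φ a) = some w') (x y : V) :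
    FiberPath G' f' w' (φ x) (φ y) :=
  ReflTransGen.lift φ (fun a b hab => ⟨hφ a b hab, hf a, hf b⟩) _ _
    ((SimpleGraph.reachable_iff_reflTransGen x y).1 (hG.preconnected x y))

end Fibers

section Routing

variable {X : Type u} {Z : Type v}

/-- The graph `K` contains disjoint connected sets, the fibres of `l`, such that the set
with index `x` contains `f x` and `g x`. -/
structure Linked (K : SimpleGraph Z) (l : Z → Option X) (f g : X → Z) : Prop where
  conn : FiberConnected K l
  left : ∀ x, l (f x) = some x
  right : ∀ x, l (g x) = some x

theorem Linked.comp {K : SimpleGraph Z} {l : Z → Option X} {f g : X → Z} (h : Linked K l f g)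
    (τ : Equiv.Perm X) : Linked K (fun z => (l z).map τ.symm) (f ∘ τ) (g ∘ τ) :=
  ⟨h.conn.map_equiv _, fun x => by simp [h.left], fun x => by simp [h.right]⟩

/-- One can route from the position `f x` to the position `g x`, for all `x` simultaneously,
through `n` consecutive copies of `K`. -/
inductive Routable (K : SimpleGraph Z) : ℕ → (X → Z) → (X → Z) → Prop
  | nil (f : X → Z) : Routable K 0 f f
  | cons {n : ℕ} {f g h : X → Z} {l : Z → Option X} (hl : Linked K l f g) (hr : Routable K n g h) :
      Routable K (n + 1) f h

theorem Routable.trans {K : SimpleGraph Z} {m n : ℕ} {f g h : X → Z} (h₁ : Routable K m f g)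
    (h₂ : Routable K n g h) : Routable K (m + n) f h := by
  induction h₁ with
  | nil => simpa using h₂
  | cons hl _ ih =>
    rw [Nat.add_right_comm]
    exact .cons hl (ih h₂)

/-- Labels are only names of the routed sets, so a routing can be reused after the points have
already been permuted by τ. -/
theorem Routable.comp {K : SimpleGraph Z} {n : ℕ} {f g : X → Z} (h : Routable K n f g)
    (τ : Equiv.Perm X) : Routable K n (f ∘ τ) (g ∘ τ) := by
  induction h with
  | nil => exact .nil _
  | cons hl _ ih => exact .cons (hl.comp τ) ih

theorem Routable.exists_labelling {K : SimpleGraph Z} {n : ℕ} {f g : X → Z}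
    (h : Routable K n f g) : ∃ (l : ℕ → Z → Option X) (p : ℕ → X → Z), p 0 = f ∧ p n = g ∧
      ∀ t < n, Linked K (l t) (p t) (p (t + 1)) := by
  induction h with
  | nil f => exact ⟨fun _ _ => none, fun _ => f, rfl, rfl, by simp⟩
  | @cons n f g h l hl _ ih =>
    obtain ⟨l', p, h0, hn, hp⟩ := ih
    refine ⟨fun t => Nat.casesOn t l l', fun t => Nat.casesOn t f p, rfl, hn, fun t ht => ?_⟩
    cases t with
    | zero => simpa [h0] using hl
    | succ t => exact hp t (by omega)

theorem cycleGraph_adj_succ {n t : ℕ} (h : t + 1 < n) :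
    (SimpleGraph.cycleGraph n).Adj ⟨t, (Nat.lt_succ_self t).trans h⟩ ⟨t + 1, h⟩ := by
  rw [SimpleGraph.cycleGraph_adj']
  right
  simp only [Fin.sub_def]
  rw [show n - t + (t + 1) = 1 + n by omega, Nat.add_mod_right, Nat.mod_eq_of_lt (by omega)]

theorem cycleGraph_adj_last {n : ℕ} (h : 1 < n) :
    (SimpleGraph.cycleGraph n).Adj ⟨n - 1, by omega⟩ ⟨0, by omega⟩ := by
  rw [SimpleGraph.cycleGraph_adj']
  right
  simp only [Fin.sub_def]
  rw [show n - (n - 1) + 0 = 1 by omega, Nat.mod_eq_of_lt h]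

/-- If the permutation `σ` of the positions can be routed through `n` copies of `K`, then the cycles
of `σ` can be realised by disjoint connected sets in the product of `K` with a cycle. -/
theorem Routable.exists_cyclic {K : SimpleGraph Z} {n : ℕ} (hn : 1 < n) {f : X → Z}
    {σ : Equiv.Perm X} (h : Routable K n f (f ∘ σ)) :
    ∃ l : Fin n × Z → Option X, FiberConnected ((SimpleGraph.cycleGraph n).boxProd K) l ∧
      (∀ x, l (⟨0, by omega⟩, f x) = some x) ∧
      ∀ x, ∃ a, l a = some x ∧
        ((SimpleGraph.cycleGraph n).boxProd K).Adj a (⟨0, by omega⟩, f (σ x)) := by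
  obtain ⟨l, p, h0, hp, hl⟩ := h.exists_labelling
  subst h0
  set G := (SimpleGraph.cycleGraph n).boxProd K
  let L : Fin n × Z → Option X := fun a => l a.1 a.2
  have layer : ∀ x t (ht : t < n) z z', l t z = some x → l t z' = some x →
      FiberPath G L x (⟨t, ht⟩, z) (⟨t, ht⟩, z') := fun x t ht z z' hz hz' =>
    FiberPath.map (G' := G) (f' := L) (w' := x) ((hl t ht).conn x z z' hz hz')
      (fun z => ((⟨t, ht⟩, z) : Fin n × Z))
      (fun a b hab => SimpleGraph.boxProd_adj.2 (Or.inr ⟨hab, rfl⟩)) fun a ha => ha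
  have key : ∀ x t (ht : t < n) z, l t z = some x →
      FiberPath G L x (⟨0, by omega⟩, p 0 x) (⟨t, ht⟩, z) := by
    intro x t
    induction t with
    | zero => exact fun ht z hz => layer x 0 ht _ _ ((hl 0 ht).left x) hz
    | succ t ih =>
      intro ht z hz
      have ht' : t < n := by omega
      refine (ih ht' _ ((hl t ht').right x)).trans (ReflTransGen.trans (FiberPath.of_adj
        (y := (⟨t + 1, ht⟩, p (t + 1) x)) ?_ ((hl t ht').right x) ((hl (t + 1) ht).left x))
        (layer x (t + 1) ht _ _ ((hl (t + 1) ht).left x) hz))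
      exact SimpleGraph.boxProd_adj.2 (Or.inl ⟨cycleGraph_adj_succ ht, rfl⟩)
  refine ⟨L, fun x a b ha hb => ?_, fun x => (hl 0 (by omega)).left x, fun x => ?_⟩
  · exact (FiberPath.symm (key x a.1 a.1.2 a.2 ha)).trans (key x b.1 b.1.2 b.2 hb)
  -- The exit of x from the last layer is next, around the cycle, to the entry of σ x in layer 0.
  · refine ⟨(⟨n - 1, by omega⟩, p n x), ?_, ?_⟩
    · have := (hl (n - 1) (by omega)).right x
      rwa [Nat.sub_add_cancel (by omega)] at this
    · refine SimpleGraph.boxProd_adj.2 (Or.inl ⟨cycleGraph_adj_last hn, ?_⟩)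
      simp [hp]

/-- The labelling that merges the connected sets with indices in the same cycle. -/
theorem Routable.exists_merged {K : SimpleGraph Z} {n : ℕ} (hn : 1 < n) {f : X → Z}
    {Y : Type w} [Finite X] (hroute : ∀ σ : Equiv.Perm X, Routable K n f (f ∘ σ)) (g : X → Y) :
    ∃ l : Fin n × Z → Option Y, FiberConnected ((SimpleGraph.cycleGraph n).boxProd K) l ∧
      ∀ x, l (⟨0, by omega⟩, f x) = some (g x) := by
  -- The orbits of σ are the nonempty fibres of g, so closing up the routes merges exactly the
  -- desired classes.
  obtain ⟨σ, hσ, horb⟩ := exists_perm_sameCycle g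
  obtain ⟨l, hl, hf, hadj⟩ := (hroute σ).exists_cyclic hn
  set G := (SimpleGraph.cycleGraph n).boxProd K
  let L : Fin n × Z → Option Y := fun a => (l a).map g
  have lift : ∀ x a b, l a = some x → l b = some x → FiberPath G L (g x) a b :=
    fun x a b ha hb => FiberPath.map (f := l) (hl x a b ha hb) id (fun _ _ h => h)
      fun c hc => by simp [L, hc]
  have hpow : ∀ (m : ℕ) x, FiberPath G L (g x) (⟨0, by omega⟩, f x)
      (⟨0, by omega⟩, f ((σ ^ m) x)) ∧ g ((σ ^ m) x) = g x := by
    intro m x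
    induction m with
    | zero => exact ⟨.refl, rfl⟩
    | succ m ih =>
      rw [pow_succ', Equiv.Perm.mul_apply]
      obtain ⟨a, ha, hadj⟩ := hadj ((σ ^ m) x)
      refine ⟨ih.1.trans (ReflTransGen.trans (b := a) ?_ (FiberPath.of_adj hadj ?_ ?_)),
        by rw [hσ, ih.2]⟩
      · have := lift _ _ a (hf ((σ ^ m) x)) ha
        rwa [ih.2] at this
      · simp [L, ha, ih.2]
      · simp [L, hf, hσ, ih.2]
  refine ⟨L, fun y a b ha hb => ?_, fun x => by simp [L, hf]⟩
  obtain ⟨x, hx, rfl⟩ := Option.map_eq_some_iff.1 ha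
  obtain ⟨x', hx', hxx'⟩ := Option.map_eq_some_iff.1 hb
  obtain ⟨m, rfl⟩ := horb x x' hxx'.symm
  refine (lift x a _ hx (hf x)).trans ((hpow m x).1.trans ?_)
  have := lift _ _ b (hf ((σ ^ m) x)) hx'
  rwa [(hpow m x).2] at this

end Routing

/-! ### Routing permutations of the product, with a factor of heights -/

section Layers

variable {ι : Type*} {V : ι → Type*} {Y : Type*} {H : SimpleGraph Y}
  {G : ∀ i, SimpleGraph (V i)}

/-- The sets H × {x} are connected and disjoint, so one layer lets every x change its height
arbitrarily. -/
theorem linked_fiber (hH : H.Connected) (a b : (∀ i, V i) → Y) :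
    Linked (H.boxProd (boxPi G)) (fun z => some z.2) (fun x => (a x, x)) (fun x => (b x, x)) := by
  refine ⟨?_, fun x => rfl, fun x => rfl⟩
  rintro w ⟨h, x⟩ ⟨h', y⟩ hx hy
  obtain rfl : x = w := Option.some.inj hx
  obtain rfl : y = x := Option.some.inj hy
  exact FiberPath.of_connected (f' := fun z : Y × (∀ i, V i) => some z.2) hH (fun h => (h, y))
    (fun a b hab => SimpleGraph.boxProd_adj.2 (Or.inl ⟨hab, rfl⟩)) (fun _ => rfl) h h'

/-- The set of x is its whole line in direction i, at height e (x i). These sets are disjoint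
because the height recovers x i and the line recovers the other coordinates. -/
theorem exists_linked_changesOnly {i : ι} (hG : (G i).Connected) {e : V i → Y}
    (he : Function.Injective e) {ρ : (∀ i, V i) → ∀ i, V i} (hρ : ChangesOnly i ρ) :
    ∃ l, Linked (H.boxProd (boxPi G)) l (fun x => (e (x i), x)) (fun x => (e (x i), ρ x)) := by
  classical
  let l : Y × (∀ i, V i) → Option (∀ i, V i) := fun z =>
    if h : ∃ a, e a = z.1 then some (Function.update z.2 i h.choose) else none
  have hl : ∀ h y x, l (h, y) = some x ↔ e (x i) = h ∧ ∀ j, j ≠ i → x j = y j := by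
    intro h y x
    by_cases hex : ∃ a, e a = h
    · have hval : l (h, y) = some (Function.update y i hex.choose) := dif_pos hex
      rw [hval]
      constructor
      · intro hx
        rw [← Option.some.inj hx]
        exact ⟨by simp [hex.choose_spec], fun j hj => by simp [hj]⟩
      · rintro ⟨h1, h2⟩
        congr 1
        funext j
        by_cases hj : j = i
        · subst hj
          rw [Function.update_self]
          exact he (hex.choose_spec.trans h1.symm)
        · rw [Function.update_of_ne hj, h2 j hj]
    · have hval : l (h, y) = none := dif_neg hex
      rw [hval]
      constructor
      · simp
      · rintro ⟨h1, -⟩; exact absurd ⟨_, h1⟩ hex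
  refine ⟨l, ?_, fun x => (hl _ _ _).2 ⟨rfl, fun _ _ => rfl⟩,
    fun x => (hl _ _ _).2 ⟨rfl, fun j hj => (hρ x j hj).symm⟩⟩
  rintro x ⟨h, y⟩ ⟨h', y'⟩ hy hy'
  obtain ⟨rfl, h2⟩ := (hl _ _ _).1 hy
  obtain ⟨rfl, h2'⟩ := (hl _ _ _).1 hy'
  have := FiberPath.of_connected (G' := H.boxProd (boxPi G)) (f' := l) (w' := x) hG
    (fun a => (e (x i), Function.update x i a))
    (fun a b hab => SimpleGraph.boxProd_adj.2 (Or.inr ⟨⟨i, by simpa using hab, fun j hj => by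
      simp [hj]⟩, rfl⟩)) (fun a => (hl _ _ _).2 ⟨rfl, fun j hj => by simp [hj]⟩) (y i) (y' i)
  have hup : ∀ z : ∀ i, V i, (∀ j, j ≠ i → x j = z j) → Function.update x i (z i) = z := by
    intro z hz
    funext j
    by_cases hj : j = i
    · subst hj; simp
    · simp [hj, hz j hj]
  rwa [hup y h2, hup y' h2'] at this

/-- A permutation of one coordinate can be routed through three layers. -/
theorem routable_of_changesOnly (hH : H.Connected) {i : ι} (hG : (G i).Connected) {e : V i → Y}
    (he : Function.Injective e) {ρ : Equiv.Perm (∀ i, V i)} (hρ : ChangesOnly i ρ) (h₀ : Y) :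
    Routable (H.boxProd (boxPi G)) 3 (fun x => (h₀, x)) (fun x => (h₀, ρ x)) := by
  obtain ⟨l, hl⟩ := exists_linked_changesOnly (H := H) hG he hρ
  -- After the move, the tuple ρ x is still at the height e (x i) of its preimage; the third layer
  -- brings it back to h₀.
  have h := (linked_fiber (G := G) hH (fun x => e (ρ.symm x i)) fun _ => h₀).comp ρ
  simp only [Function.comp_def, Equiv.symm_apply_apply] at h
  exact .cons (linked_fiber hH (fun _ => h₀) fun x => e (x i)) (.cons hl (.cons h (.nil _)))

theorem routable_perm [Finite ι] [Nonempty ι] [∀ i, Finite (V i)] (hH : H.Connected)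
    (hG : ∀ i, (G i).Connected) (e : ∀ i, V i → Y) (he : ∀ i, Function.Injective (e i))
    (h₀ : Y) (σ : Equiv.Perm (∀ i, V i)) :
    Routable (H.boxProd (boxPi G)) (6 * Nat.card ι - 2) (fun x => (h₀, x))
      ((fun x => (h₀, x)) ∘ σ) := by
  have := Fintype.ofFinite ι
  obtain ⟨l, hl, rfl, hmem⟩ := exists_prod_eq_of_forall_notMem Finset.univ
    Finset.univ_nonempty σ (by simp)
  have key : ∀ l : List (Equiv.Perm (∀ i, V i)), (∀ ρ ∈ l, ∃ i, ChangesOnly i ρ) →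
      Routable (H.boxProd (boxPi G)) (3 * l.length) (fun x => (h₀, x))
        ((fun x => (h₀, x)) ∘ l.prod) := by
    intro l
    induction l with
    | nil => exact fun _ => .nil _
    | cons ρ l ih =>
      intro h
      obtain ⟨i, hi⟩ := h ρ (by simp)
      have h1 := ih fun ρ' hρ' => h ρ' (by simp [hρ'])
      have h2 := (routable_of_changesOnly hH (hG i) (he i) hi h₀).comp l.prod
      have h3 := h1.trans h2
      rw [List.length_cons, mul_add]
      exact h3
  rw [Nat.card_eq_fintype_card, show 6 * Fintype.card ι - 2 = 3 * l.length + 1 by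
    rw [Finset.card_univ] at hl; omega]
  -- The idle layer, where every point stays at height h₀, pads 3(2n - 1) to the cycle length.
  exact .cons (linked_fiber hH _ _) (key l hmem)

end Layers

/-! ### Building the minor from two merged copies -/

theorem FiberConnected.join {V : Type u} {W : Type v} {G : SimpleGraph V}
    {f : V → Option (Option W)} (h : FiberConnected G f) : FiberConnected G fun x => (f x).join := by
  have key : ∀ x w, (f x).join = some w ↔ f x = some (some w) := fun x w => by
    rw [Option.join_eq_some_iff]
  intro w x y hx hy
  exact FiberPath.map (h (some w) x y ((key x w).1 hx) ((key y w).1 hy)) id (fun _ _ h => h)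
    fun a ha => (key a w).2 ha

/-- Suppose that in `Q` any classes of the positions in `X` can be merged into disjoint connected
sets. Then the product of `Q` with an edge contains all graphs with at most `|X| / 2` edges and
without isolated vertices as minors. -/
theorem exists_isModel_of_merge {W : Type v} {X : Type u} {Z : Type*} {T : Type*}
    {H : SimpleGraph W} (hH : ∀ w, ∃ w', H.Adj w w') {A : SimpleGraph T} {a b : T}
    (hab : A.Adj a b) {Q : SimpleGraph Z} (q : X → Z)
    (hmerge : ∀ (Y : Type v) (g : X → Y), ∃ l : Z → Option Y, FiberConnected Q l ∧
      ∀ x, l (q x) = some (g x)) (p : H.Dart → X) (hp : Function.Injective p) :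
    ∃ f, IsModel H (A.boxProd Q) f := by
  classical
  -- Unused positions are merged into an extra class `none`, whose label is then erased.
  have hmerge' : ∀ (Y : Type v) (g : X → Option Y), ∃ l : Z → Option Y, FiberConnected Q l ∧
      ∀ x, l (q x) = g x := fun Y g => by
    obtain ⟨l, hl, hg⟩ := hmerge (Option Y) g
    exact ⟨_, hl.join, fun x => by simp [hg]⟩
  obtain ⟨la, hla, hga⟩ := hmerge' W fun x => (Function.partialInv p x).map fun d => d.fst
  let toEdge : H.Dart → H.edgeSet := fun d => ⟨d.edge, d.edge_mem⟩
  obtain ⟨lb, hlb, hgb⟩ := hmerge' H.edgeSet fun x =>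
    (Function.partialInv p x).map toEdge
  have ha : ∀ d, la (q (p d)) = some d.fst := fun d => by
    rw [hga, Function.partialInv_left hp]; rfl
  have hb : ∀ d, lb (q (p d)) = some (toEdge d) := fun d => by
    rw [hgb, Function.partialInv_left hp]; rfl
  have hdart : ∀ e : H.edgeSet, ∃ d : H.Dart, d.edge = e := by
    rintro ⟨e, he⟩
    induction e with
    | _ x y => exact ⟨⟨(x, y), he⟩, rfl⟩
  choose r hr using hdart
  -- Each edge class in copy b is given to the tail of a chosen dart `r e`, to which it is attached
  -- by the rung at that dart; the rung at the reversed dart then realises the adjacency with the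
  -- other end.
  let F : T × Z → Option W := fun t =>
    if t.1 = a then la t.2 else if t.1 = b then (lb t.2).map fun e => (r e).fst else none
  have hFa : ∀ z, F (a, z) = la z := fun z => if_pos rfl
  have hFb : ∀ z, F (b, z) = (lb z).map fun e => (r e).fst := fun z => by
    simp [F, hab.ne.symm]
  have hadj : ∀ z, (A.boxProd Q).Adj (b, z) (a, z) := fun z =>
    SimpleGraph.boxProd_adj.2 (Or.inl ⟨hab.symm, rfl⟩)
  have hedge : ∀ d, F (b, q (p d)) = some (r (toEdge d)).fst := fun d => by
    rw [hFb, hb]; rfl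
  have htoA : ∀ w t, F t = some w → ∃ z, la z = some w ∧
      FiberPath (A.boxProd Q) F w t (a, z) := by
    rintro w ⟨h, z⟩ hF
    by_cases h1 : h = a
    · subst h1
      exact ⟨z, (hFa z).symm.trans hF, .refl⟩
    by_cases h2 : h = b
    · subst h2
      rw [hFb] at hF
      obtain ⟨e, he, rfl⟩ := Option.map_eq_some_iff.1 hF
      have hre : lb (q (p (r e))) = some e := by
        rw [hb]; exact congrArg some (Subtype.ext (hr e))
      have hrF : F (h, q (p (r e))) = some (r e).fst := by rw [hFb, hre]; rfl
      refine ⟨q (p (r e)), ha _, ReflTransGen.trans (FiberPath.map (f := lb)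
        (hlb e z _ he hre) (fun z => (h, z)) (fun x y hxy => ?_) fun x hx => ?_)
        (FiberPath.of_adj (hadj _) hrF ((hFa _).trans (ha _)))⟩
      · exact SimpleGraph.boxProd_adj.2 (Or.inr ⟨hxy, rfl⟩)
      · rw [hFb, hx]; rfl
    · simp [F, h1, h2] at hF
  refine ⟨F, fun w => ?_, fun w x y hx hy => ?_, fun w w' hw => ?_⟩
  · obtain ⟨w', hw⟩ := hH w
    exact ⟨(a, q (p ⟨(w, w'), hw⟩)), by rw [hFa, ha]⟩
  · obtain ⟨z, hz, hxz⟩ := htoA w x hx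
    obtain ⟨z', hz', hyz⟩ := htoA w y hy
    refine hxz.trans (ReflTransGen.trans (b := (a, z')) ?_ (FiberPath.symm hyz))
    exact FiberPath.map (f := la) (hla w z z' hz hz') (fun z => (a, z))
      (fun x y hxy => SimpleGraph.boxProd_adj.2 (Or.inr ⟨hxy, rfl⟩))
      fun x hx => (hFa x).trans hx
  · let d : H.Dart := ⟨(w, w'), hw⟩
    rcases SimpleGraph.dart_edge_eq_iff _ _ |>.1 (hr (toEdge d)) with h | h
    · refine ⟨(b, q (p d.symm)), (a, q (p d.symm)), ?_, by rw [hFa, ha]; rfl, hadj _⟩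
      have hsymm : toEdge d.symm = toEdge d := Subtype.ext d.edge_symm
      rw [hedge, hsymm, h]
    · refine ⟨(a, q (p d)), (b, q (p d)), by rw [hFa, ha], ?_, (hadj _).symm⟩
      rw [hedge, h]; rfl

theorem natCard_dart {W : Type v} [Finite W] (H : SimpleGraph W) :
    Nat.card H.Dart = 2 * H.edgeSet.ncard := by
  classical
  have := Fintype.ofFinite W
  rw [Nat.card_eq_fintype_card, H.dart_card_eq_twice_card_edges, ← SimpleGraph.coe_edgeFinset,
    Set.ncard_coe_finset]

theorem isMinorUniversal_product {k n : ℕ} (hn : 1 ≤ n) {V : Fin n → Type*} [∀ i, Finite (V i)]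
    (G : ∀ i, SimpleGraph (V i)) {W₄ : Type*} [Finite W₄] (H₄ : SimpleGraph W₄)
    {Wₖ : Type*} [Finite Wₖ] (Hₖ : SimpleGraph Wₖ) (hV : ∀ i, Nat.card (V i) ≤ k)
    (hG : ∀ i, (G i).Connected) (h₄ : Nat.card W₄ = 4) (hH₄ : H₄.Connected)
    (hₖ : Nat.card Wₖ = k) (hHₖ : Hₖ.Connected) :
    IsMinorUniversal (H₄.boxProd ((SimpleGraph.cycleGraph (6 * n - 2)).boxProd
      (Hₖ.boxProd (boxPi G)))) ((1 / 16 : ℝ) * ∏ i, (Nat.card (V i) : ℝ)) := by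
  classical
  intro W _ H hH hm
  have := Fintype.ofFinite W₄
  have := Fintype.ofFinite Wₖ
  have := fun i => Fintype.ofFinite (V i)
  have : NeZero n := ⟨by omega⟩
  have : Nontrivial W₄ := Finite.one_lt_card_iff_nontrivial.1 (by omega)
  obtain ⟨a⟩ := hH₄.nonempty
  obtain ⟨b, hab⟩ := hH₄.preconnected.exists_adj_of_nontrivial a
  obtain ⟨h₀⟩ := hHₖ.nonempty
  have he : ∀ i, ∃ e : V i → Wₖ, Function.Injective e := fun i => by
    obtain ⟨e⟩ := Function.Embedding.nonempty_of_card_le (α := V i) (β := Wₖ) (by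
      rw [← Nat.card_eq_fintype_card, ← Nat.card_eq_fintype_card, hₖ]; exact hV i)
    exact ⟨e, e.injective⟩
  choose e he using he
  -- Every edge uses two positions, so the factor 1/2 in place of 1/16 would suffice here.
  have hdart : Nat.card H.Dart ≤ Nat.card (∀ i, V i) := by
    rw [natCard_dart, Nat.card_pi]
    rw [← Nat.cast_prod] at hm
    have h0 : (0 : ℝ) ≤ ((∏ i, Nat.card (V i) : ℕ) : ℝ) := Nat.cast_nonneg _
    have : ((2 * H.edgeSet.ncard : ℕ) : ℝ) ≤ ((∏ i, Nat.card (V i) : ℕ) : ℝ) := by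
      rw [Nat.cast_mul, Nat.cast_ofNat]
      linarith
    exact_mod_cast this
  have : Finite H.Dart := by
    have := Fintype.ofFinite W
    infer_instance
  have := Fintype.ofFinite H.Dart
  obtain ⟨p⟩ := Function.Embedding.nonempty_of_card_le (α := H.Dart) (β := ∀ i, V i) (by
    rwa [← Nat.card_eq_fintype_card, ← Nat.card_eq_fintype_card])
  have hroute := routable_perm hHₖ hG e he h₀
  rw [Nat.card_fin] at hroute
  obtain ⟨f, hf⟩ := exists_isModel_of_merge hH hab _
    (fun Y g => Routable.exists_merged (by omega) hroute g) p p.injective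
  exact hf.isMinor

/-! ### Upper bound: the size of the levels -/

section

open Finset

section Levels

open Complex MeasureTheory

theorem integral_exp_int_mul (m : ℤ) :
    ∫ θ in (-Real.pi)..Real.pi, exp (m * I * θ) = if m = 0 then 2 * Real.pi else 0 := by
  split_ifs with h
  · subst h
    simp
    ring
  · rw [integral_exp_mul_complex (by simp [h, I_ne_zero]), ofReal_zero, div_eq_zero_iff]
    left
    rw [sub_eq_zero, exp_eq_exp_iff_exists_int]
    exact ⟨m, by push_cast; ring⟩

/-- The square of the norm is (r + 1)² - 2r(1 - cos θ); use 1 - cos θ ≥ 2θ²/π² on [-π, π] and then 1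
+ x ≤ exp x. -/
theorem norm_add_exp_le (r : ℕ) {θ : ℝ} (hθ : |θ| ≤ Real.pi) :
    ‖(r : ℂ) + exp (θ * I)‖ ≤
      (r + 1) * Real.exp (-(2 * r / (Real.pi ^ 2 * (r + 1) ^ 2)) * θ ^ 2) := by
  have hr : (0 : ℝ) ≤ r := Nat.cast_nonneg r
  refine le_of_sq_le_sq ?_ (by positivity)
  rw [← normSq_eq_norm_sq, exp_mul_I, ← ofReal_cos, ← ofReal_sin, mul_pow, ← Real.exp_nat_mul]
  have h1 : normSq ((r : ℂ) + (Real.cos θ + Real.sin θ * I)) =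
      (r + 1) ^ 2 - 2 * r * (1 - Real.cos θ) := by
    rw [show (r : ℂ) + (Real.cos θ + Real.sin θ * I) =
      ((r + Real.cos θ : ℝ) : ℂ) + (Real.sin θ : ℝ) * I by push_cast; ring, normSq_add_mul_I]
    nlinarith [Real.sin_sq_add_cos_sq θ]
  rw [h1]
  have h2 := Real.cos_le_one_sub_mul_cos_sq hθ
  have h3 := Real.add_one_le_exp ((2 : ℕ) * (-(2 * r / (Real.pi ^ 2 * (r + 1) ^ 2)) * θ ^ 2))
  calc ((r : ℝ) + 1) ^ 2 - 2 * r * (1 - Real.cos θ)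
      ≤ (r + 1) ^ 2 - 2 * r * (2 / Real.pi ^ 2 * θ ^ 2) := by
        have := mul_le_mul_of_nonneg_left h2 hr
        linarith
    _ = (r + 1) ^ 2 * ((2 : ℕ) * (-(2 * r / (Real.pi ^ 2 * (r + 1) ^ 2)) * θ ^ 2) + 1) := by
        have := Real.pi_ne_zero
        field_simp
        push_cast
        ring
    _ ≤ _ := mul_le_mul_of_nonneg_left h3 (by positivity)

theorem sum_exp_card_eq (r n : ℕ) (θ : ℝ) :
    ∑ y : Fin n → Fin (r + 1), exp ((#{i | y i = 0} : ℕ) * I * θ) =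
      ((r : ℂ) + exp (θ * I)) ^ n := by
  have h : ∑ a : Fin (r + 1), (if a = 0 then exp (θ * I) else 1) = (r : ℂ) + exp (θ * I) := by
    rw [Fin.sum_univ_succ]
    simp [Fin.succ_ne_zero, add_comm]
  rw [← h, Fintype.sum_pow]
  refine sum_congr rfl fun y _ => ?_
  rw [prod_ite, prod_const, prod_const_one, mul_one, ← exp_nat_mul]
  congr 1
  ring

/-- The number of tuples in `Fin (r + 1)` with a given number of zeros is
`O((r + 1) ^ n / √n)`. -/
theorem card_level_le {r : ℕ} (hr : 1 ≤ r) {n : ℕ} (hn : 1 ≤ n) (j : ℕ) :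
    (#{y : Fin n → Fin (r + 1) | #{i | y i = 0} = j} : ℝ) ≤
      √(Real.pi / (2 * r / (Real.pi ^ 2 * (r + 1) ^ 2))) * (r + 1) ^ n / √n := by
  set c : ℝ := 2 * r / (Real.pi ^ 2 * (r + 1) ^ 2) with hc
  have hc0 : 0 < c := by positivity
  have hn0 : (0 : ℝ) < n := by exact_mod_cast hn
  -- The level size is the coefficient of z^j in (r + z)^n, extracted by Fourier inversion; the
  -- Gaussian bound on |r + e^{iθ}| then gives the factor 1/√n.
  have key : ((2 * Real.pi * #{y : Fin n → Fin (r + 1) | #{i | y i = 0} = j} : ℝ) : ℂ) =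
      ∫ θ in (-Real.pi)..Real.pi, exp (-(j * I * θ)) * ((r : ℂ) + exp (θ * I)) ^ n := by
    have h1 : ∀ θ : ℝ, exp (-(j * I * θ)) * ((r : ℂ) + exp (θ * I)) ^ n =
        ∑ y : Fin n → Fin (r + 1), exp ((((#{i | y i = 0} : ℕ) - j : ℤ) : ℂ) * I * θ) := by
      intro θ
      rw [← sum_exp_card_eq, mul_sum]
      refine sum_congr rfl fun y _ => ?_
      rw [← exp_add]
      congr 1
      push_cast
      ring
    simp_rw [h1]
    rw [intervalIntegral.integral_finsetSum fun y _ =>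
      (Continuous.intervalIntegrable (by fun_prop) _ _)]
    simp_rw [integral_exp_int_mul, sub_eq_zero, Nat.cast_inj]
    rw [← ofReal_sum, ← sum_filter, sum_const, nsmul_eq_mul, mul_comm]
  have hint : Integrable fun θ : ℝ => Real.exp (-(c * n) * θ ^ 2) :=
    integrable_exp_neg_mul_sq (by positivity)
  have hbound : 2 * Real.pi * (#{y : Fin n → Fin (r + 1) | #{i | y i = 0} = j} : ℝ) ≤
      (r + 1) ^ n * √(Real.pi / (c * n)) := by
    calc _ = ‖((2 * Real.pi * #{y : Fin n → Fin (r + 1) | #{i | y i = 0} = j} : ℝ) : ℂ)‖ := by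
          rw [norm_real, Real.norm_of_nonneg (by positivity)]
      _ ≤ ∫ θ in (-Real.pi)..Real.pi, (r + 1) ^ n * Real.exp (-(c * n) * θ ^ 2) := by
          rw [key]
          refine intervalIntegral.norm_integral_le_of_norm_le (by linarith [Real.pi_pos])
            (Filter.Eventually.of_forall fun θ hθ => ?_)
            (Continuous.intervalIntegrable (by fun_prop) _ _)
          have hexp : ‖exp (-(j * I * θ))‖ = 1 := by
            rw [show -((j : ℂ) * I * θ) = ((-(j * θ) : ℝ) : ℂ) * I by push_cast; ring]
            exact norm_exp_ofReal_mul_I _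
          rw [norm_mul, hexp, one_mul, norm_pow]
          refine (pow_le_pow_left₀ (norm_nonneg _) (norm_add_exp_le r
            (abs_le.2 ⟨hθ.1.le, hθ.2⟩)) n).trans_eq ?_
          rw [mul_pow, ← Real.exp_nat_mul, ← hc]
          congr 2
          ring
      _ = (r + 1) ^ n * ∫ θ in (-Real.pi)..Real.pi, Real.exp (-(c * n) * θ ^ 2) := by
          rw [intervalIntegral.integral_const_mul]
      _ ≤ (r + 1) ^ n * ∫ θ : ℝ, Real.exp (-(c * n) * θ ^ 2) := by
          refine mul_le_mul_of_nonneg_left ?_ (by positivity)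
          rw [intervalIntegral.integral_of_le (by linarith [Real.pi_pos])]
          exact setIntegral_le_integral hint
            (Filter.Eventually.of_forall fun θ => (Real.exp_pos _).le)
      _ = _ := by rw [integral_gaussian]
  have hpi : 1 ≤ 2 * Real.pi := by linarith [Real.two_le_pi]
  calc (#{y : Fin n → Fin (r + 1) | #{i | y i = 0} = j} : ℝ)
      ≤ 2 * Real.pi * (#{y : Fin n → Fin (r + 1) | #{i | y i = 0} = j} : ℝ) :=
        le_mul_of_one_le_left (Nat.cast_nonneg _) hpi
    _ ≤ _ := hbound
    _ = _ := by
        rw [← div_div, Real.sqrt_div (by positivity)]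
        ring

end Levels

/-! ### Sparse graphs without small separators -/

section Expander

/-- There are `22 M` pairs of elements of `Fin M` that hit all products of two sets with at least
`M / 4` elements. -/
theorem exists_pairs {M : ℕ} (hM : 0 < M) : ∃ f : Fin (22 * M) → Fin M × Fin M,
    ∀ A B : Finset (Fin M), M ≤ 4 * #A → M ≤ 4 * #B → ∃ i, f i ∈ A ×ˢ B := by
  classical
  by_contra! h
  -- Union bound: at most 4^M choices of (A, B), each missed by at most a (15/16)^(22M) proportion
  -- of all sequences. The constant 22 is the least with 4 · (15/16)^22 < 1.
  have hsub : (univ : Finset (Fin (22 * M) → Fin M × Fin M)) ⊆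
      ({P | M ≤ 4 * #P.1 ∧ M ≤ 4 * #P.2} : Finset (Finset (Fin M) × Finset (Fin M))).biUnion
        fun P => Fintype.piFinset fun _ => (P.1 ×ˢ P.2)ᶜ := by
    intro f _
    obtain ⟨A, B, hA, hB, hf⟩ := h f
    refine mem_biUnion.2 ⟨(A, B), by simp [hA, hB], Fintype.mem_piFinset.2 fun i => ?_⟩
    exact mem_compl.2 (hf i)
  have h1 := (card_le_card hsub).trans card_biUnion_le
  have h2 : ∀ P ∈ ({P | M ≤ 4 * #P.1 ∧ M ≤ 4 * #P.2} :
      Finset (Finset (Fin M) × Finset (Fin M))),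
      16 ^ (22 * M) * #(Fintype.piFinset fun _ : Fin (22 * M) => (P.1 ×ˢ P.2)ᶜ) ≤
        (15 * M ^ 2) ^ (22 * M) := by
    intro P hP
    obtain ⟨hA, hB⟩ := (mem_filter.1 hP).2
    rw [Fintype.card_piFinset_const, ← mul_pow]
    refine Nat.pow_le_pow_left ?_ _
    have hc := card_add_card_compl (P.1 ×ˢ P.2)
    rw [card_product, Fintype.card_prod, Fintype.card_fin] at hc
    nlinarith [Nat.mul_le_mul hA hB]
  have h3 : 16 ^ (22 * M) * (M ^ 2) ^ (22 * M) ≤ 4 ^ M * (15 * M ^ 2) ^ (22 * M) := by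
    calc 16 ^ (22 * M) * (M ^ 2) ^ (22 * M)
        = 16 ^ (22 * M) * #(univ : Finset (Fin (22 * M) → Fin M × Fin M)) := by
          simp [sq]
      _ ≤ _ := Nat.mul_le_mul_left _ h1
      _ ≤ _ := by
          rw [mul_sum]
          refine (sum_le_card_nsmul _ _ _ h2).trans ?_
          rw [smul_eq_mul]
          refine Nat.mul_le_mul_right _ ((card_filter_le _ _).trans_eq ?_)
          simp [← mul_pow]
  rw [mul_pow 15, ← mul_assoc] at h3
  have h4 := Nat.le_of_mul_le_mul_right h3 (by positivity)
  rw [pow_mul, pow_mul, ← mul_pow] at h4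
  exact absurd h4 (not_le.2 (Nat.pow_lt_pow_left (by norm_num) hM.ne'))

/-- Sparse graphs in which all disjoint large sets of vertices are joined by an edge. -/
theorem exists_sparse_graph {M : ℕ} (hM : 2 ≤ M) : ∃ H : SimpleGraph (Fin M),
    (∀ w, ∃ w', H.Adj w w') ∧ H.edgeSet.ncard ≤ 23 * M ∧
    ∀ A B : Finset (Fin M), Disjoint A B → M ≤ 4 * #A → M ≤ 4 * #B →
      ∃ a ∈ A, ∃ b ∈ B, H.Adj a b := by
  classical
  obtain ⟨f, hf⟩ := exists_pairs (M := M) (by omega)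
  let o : Fin M := ⟨0, by omega⟩
  -- A star centred at `o` removes isolated vertices at the cost of at most M further edges.
  let H : SimpleGraph (Fin M) := SimpleGraph.fromRel fun a b => a = o ∨ ∃ i, f i = (a, b)
  have hH : ∀ a b, H.Adj a b ↔ a ≠ b ∧ ((a = o ∨ ∃ i, f i = (a, b)) ∨ b = o ∨ ∃ i, f i = (b, a)) :=
    fun a b => SimpleGraph.fromRel_adj _ a b
  refine ⟨H, fun w => ?_, ?_, fun A B hAB hA hB => ?_⟩
  · by_cases h : w = o
    · exact ⟨⟨1, by omega⟩, (hH _ _).2 ⟨by rw [h]; simp [o], Or.inl (Or.inl h)⟩⟩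
    · exact ⟨o, (hH _ _).2 ⟨h, Or.inr (Or.inl rfl)⟩⟩
  · have hsub : H.edgeSet ⊆ ((univ.image fun i => s((f i).1, (f i).2)) ∪
        univ.image fun v => s(o, v) : Finset (Sym2 (Fin M))) := by
      intro e he
      induction e with
      | _ a b =>
        simp only [coe_union, coe_image, coe_univ, Set.image_univ, Set.mem_union, Set.mem_range]
        rcases ((hH a b).1 he).2 with (rfl | ⟨i, hi⟩) | (rfl | ⟨i, hi⟩)
        · exact Or.inr ⟨b, rfl⟩
        · exact Or.inl ⟨i, by rw [hi]⟩
        · exact Or.inr ⟨a, Sym2.eq_swap⟩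
        · exact Or.inl ⟨i, by rw [hi]; exact Sym2.eq_swap⟩
    refine (Set.ncard_le_ncard hsub (finite_toSet _)).trans ?_
    rw [Set.ncard_coe_finset]
    refine (card_union_le _ _).trans ((Nat.add_le_add card_image_le card_image_le).trans ?_)
    simp
    omega
  · obtain ⟨i, hi⟩ := hf A B hA hB
    obtain ⟨h1, h2⟩ := mem_product.1 hi
    exact ⟨_, h1, _, h2, (hH _ _).2 ⟨fun h => disjoint_left.1 hAB h1 (h ▸ h2),
      Or.inl (Or.inr ⟨i, rfl⟩)⟩⟩

end Expander

/-! ### Levels as separators, and the final contradiction -/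

/-- A graph with a layering by small levels does not have minors in which all disjoint large sets
of vertices are joined by an edge. -/
theorem not_isMinor_of_levels {V : Type u} [Finite V] {G : SimpleGraph V} {φ : V → ℕ}
    (hφ : ∀ x y, G.Adj x y → φ y ≤ φ x + 1) {L M : ℕ} (hL : ∀ j, {x | φ x = j}.ncard ≤ L)
    (hM : 0 < M) (hLM : 8 * L ≤ M) {H : SimpleGraph (Fin M)}
    (hH : ∀ A B : Finset (Fin M), Disjoint A B → M ≤ 4 * #A → M ≤ 4 * #B →
      ∃ a ∈ A, ∃ b ∈ B, H.Adj a b) : ¬ IsMinor H G := by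
  classical
  intro hminor
  obtain ⟨f, hf⟩ := hminor.exists_isModel
  let R : ℕ → Finset (Fin M) := fun j => {w | ∀ x, f x = some w → φ x < j}
  let S : ℕ → Finset (Fin M) := fun j => {w | ∃ x, f x = some w ∧ φ x = j}
  have hS : ∀ j, #(S j) ≤ L := fun j => by
    refine le_trans ?_ (hL j)
    rw [← Set.ncard_coe_finset, ← Set.ncard_image_of_injective _ (Option.some_injective _)]
    refine (Set.ncard_le_ncard ?_ (Set.toFinite _)).trans
      (Set.ncard_image_le (f := f) (Set.toFinite {x | φ x = j}))
    rintro _ ⟨w, hw, rfl⟩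
    obtain ⟨x, hx, hj⟩ := (mem_filter.1 hw).2
    exact ⟨x, hj, hx⟩
  have hex : ∃ j, M ≤ 4 * #(R j) := by
    obtain ⟨m, hm⟩ := (Set.finite_range φ).bddAbove
    refine ⟨m + 1, ?_⟩
    have : R (m + 1) = univ := by
      ext w
      simp only [R, mem_filter, mem_univ, true_and, iff_true]
      exact fun x _ => Nat.lt_succ_of_le (hm ⟨x, rfl⟩)
    rw [this, card_univ, Fintype.card_fin]
    omega
  have hR0 : R 0 = ∅ := by
    refine eq_empty_of_forall_notMem fun w hw => ?_
    obtain ⟨x, hx⟩ := hf.surj w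
    exact absurd ((mem_filter.1 hw).2 x hx) (by omega)
  -- j + 1 is the first threshold with at least M/4 branch sets strictly below it. Fewer than M/4
  -- lie below j and at most 2L ≤ M/4 meet levels j or j + 1, so more than M/2 lie in levels at
  -- least j + 2, with no edge down to levels at most j.
  obtain ⟨j, hj⟩ : ∃ j, Nat.find hex = j + 1 := by
    refine Nat.exists_eq_succ_of_ne_zero fun h => ?_
    have := Nat.find_spec hex
    rw [h, hR0, card_empty] at this
    omega
  have hj1 : M ≤ 4 * #(R (j + 1)) := hj ▸ Nat.find_spec hex
  have hj0 : 4 * #(R j) < M := not_le.1 (Nat.find_min hex (by omega))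
  let T : Finset (Fin M) := {w | ∀ x, f x = some w → j + 2 ≤ φ x}
  have hcover : (univ : Finset (Fin M)) ⊆ R j ∪ S j ∪ S (j + 1) ∪ T := by
    intro w _
    by_contra hw
    simp only [mem_union, not_or] at hw
    obtain ⟨⟨⟨hR, hS0⟩, hS1⟩, hT⟩ := hw
    simp only [R, S, T, mem_filter, mem_univ, true_and, not_forall, not_exists, not_and]
      at hR hS0 hS1 hT
    obtain ⟨x, hx, hxj⟩ := hR
    obtain ⟨y, hy, hyj⟩ := hT
    have hpath := hf.conn w y x hy hx
    have : φ x < j := by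
      -- A path starting below level j and avoiding it stays below, since each step climbs at most
      -- one level.
      have hne : ∀ z, f z = some w → φ z ≠ j ∧ φ z ≠ j + 1 := fun z hz => ⟨hS0 z hz, hS1 z hz⟩
      induction hpath with
      | refl =>
        have := hne y hy
        omega
      | @tail b c _ hbc ih =>
        have h1 : φ b < j := by
          by_cases h : φ b < j
          · exact h
          · exact ih hbc.2.1 h
        have h2 := hφ b c hbc.1
        have h3 := hne c hbc.2.2
        omega
    exact hxj this
  have hcard : M ≤ #(R j) + L + L + #T := by
    have h := card_le_card hcover
    rw [card_univ, Fintype.card_fin] at h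
    refine h.trans ((card_union_le _ _).trans (Nat.add_le_add_right ?_ _))
    refine (card_union_le _ _).trans (Nat.add_le_add ?_ (hS _))
    exact (card_union_le _ _).trans (Nat.add_le_add_left (hS _) _)
  obtain ⟨a, ha, b, hb, hab⟩ := hH (R (j + 1)) T (by
    rw [disjoint_left]
    intro w hw hw'
    obtain ⟨x, hx⟩ := hf.surj w
    have h1 := (mem_filter.1 hw).2 x hx
    have h2 := (mem_filter.1 hw').2 x hx
    omega) hj1 (by omega)
  obtain ⟨x, y, hx, hy, hxy⟩ := hf.adj a b hab
  have h1 := (mem_filter.1 ha).2 x hx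
  have h2 := (mem_filter.1 hb).2 y hy
  have h3 := hφ x y hxy
  omega

theorem not_isMinorUniversal_boxPi {k : ℕ} (hk : 2 ≤ k) : ∃ C : ℝ, 0 < C ∧ ∀ n : ℕ, 1 ≤ n →
    ∀ (V : Fin n → Type*) [∀ i, Finite (V i)] (G : ∀ i, SimpleGraph (V i)),
      (∀ i, Nat.card (V i) ≤ k) →
      ¬ IsMinorUniversal (boxPi G) (C * (k : ℝ) ^ n / Real.sqrt n) := by
  classical
  obtain ⟨r, rfl⟩ : ∃ r, k = r + 1 := ⟨k - 1, by omega⟩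
  set c := √(Real.pi / (2 * r / (Real.pi ^ 2 * (r + 1) ^ 2))) with hc
  have hc0 : 0 ≤ c := Real.sqrt_nonneg _
  -- 184 = 23 · 8: at most 23 edges per vertex, on 8 times the level bound many vertices. The + 1
  -- absorbs the rounding of the level bound, as 1 ≤ kⁿ/√n.
  refine ⟨184 * (c + 1), by positivity, fun n hn V _ G hV huniv => ?_⟩
  have := fun i => Fintype.ofFinite (V i)
  have he : ∀ i, ∃ e : V i → Fin (r + 1), Function.Injective e := fun i => by
    obtain ⟨e⟩ := Function.Embedding.nonempty_of_card_le (α := V i) (β := Fin (r + 1)) (by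
      rw [← Nat.card_eq_fintype_card, Fintype.card_fin]; exact hV i)
    exact ⟨e, e.injective⟩
  choose e he using he
  let φ : (∀ i, V i) → ℕ := fun x => #{i | e i (x i) = 0}
  set B : ℝ := c * (r + 1) ^ n / √n with hB
  have hB0 : 0 ≤ B := by positivity
  have hlevel : ∀ j, {x | φ x = j}.ncard ≤ ⌊B⌋₊ + 1 := by
    intro j
    have h1 : {x | φ x = j}.ncard ≤ #{y : Fin n → Fin (r + 1) | #{i | y i = 0} = j} := by
      rw [← Set.ncard_coe_finset]
      refine Set.ncard_le_ncard_of_injOn (fun x i => e i (x i)) (fun x hx => ?_)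
        (fun x _ y _ h => funext fun i => he i (congrFun h i)) (finite_toSet _)
      simpa [φ] using hx
    refine h1.trans ((Nat.le_floor ?_).trans (Nat.le_succ _))
    exact card_level_le (by omega) hn j
  have hφ : ∀ x y, (boxPi G).Adj x y → φ y ≤ φ x + 1 := by
    rintro x y ⟨i, -, hi⟩
    refine (card_le_card (t := insert i ({i | e i (x i) = 0} : Finset (Fin n))) fun j hj => ?_).trans
      (card_insert_le _ _)
    rw [mem_insert]
    by_cases h : j = i
    · exact Or.inl h
    · refine Or.inr ?_
      simpa [hi j h] using hj
  obtain ⟨H, hiso, hedge, hsep⟩ := exists_sparse_graph (M := 8 * (⌊B⌋₊ + 1)) (by omega)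
  refine not_isMinor_of_levels hφ hlevel (by omega) le_rfl hsep (huniv _ H hiso ?_)
  have hn0 : (0 : ℝ) < √n := Real.sqrt_pos.2 (by exact_mod_cast hn)
  have h1 : 1 ≤ ((r : ℝ) + 1) ^ n / √n := by
    rw [one_le_div hn0]
    have h2 : (n : ℝ) ≤ (r + 1) ^ n := by
      have : n < (r + 1) ^ n := Nat.lt_pow_self (by omega)
      exact_mod_cast this.le
    refine le_trans (Real.sqrt_le_self_iff.2 (Or.inr ?_)) h2
    exact_mod_cast hn
  calc (H.edgeSet.ncard : ℝ) ≤ (23 * (8 * (⌊B⌋₊ + 1)) : ℕ) := by exact_mod_cast hedge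
    _ = 184 * (⌊B⌋₊ + 1) := by push_cast; ring
    _ ≤ 184 * (B + ((r : ℝ) + 1) ^ n / √n) := by
        have := Nat.floor_le hB0
        linarith
    _ = _ := by rw [hB]; push_cast; ring

end

end ProductMinors

theorem theoremB (k : ℕ) :
    (∀ (n : ℕ), 1 ≤ n →
      ∀ (V : Fin n → Type*) [∀ i, Finite (V i)] (G : ∀ i, SimpleGraph (V i))
        (W₄ : Type*) [Finite W₄] (H₄ : SimpleGraph W₄)
        (Wₖ : Type*) [Finite Wₖ] (Hₖ : SimpleGraph Wₖ),
        (∀ i, Nat.card (V i) ≤ k) → (∀ i, (G i).Connected) →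
        Nat.card W₄ = 4 → H₄.Connected →
        Nat.card Wₖ = k → Hₖ.Connected →
        ProductMinors.IsMinorUniversal
          (H₄.boxProd ((SimpleGraph.cycleGraph (6 * n - 2)).boxProd
            (Hₖ.boxProd (ProductMinors.boxPi G))))
          ((1 / 16 : ℝ) * ∏ i, (Nat.card (V i) : ℝ))) ∧
    (2 ≤ k → ∃ C : ℝ, 0 < C ∧ ∀ (n : ℕ), 1 ≤ n →
      ∀ (V : Fin n → Type*) [∀ i, Finite (V i)] (G : ∀ i, SimpleGraph (V i)),
        (∀ i, Nat.card (V i) ≤ k) →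
        ¬ ProductMinors.IsMinorUniversal (ProductMinors.boxPi G)
          (C * (k : ℝ) ^ n / Real.sqrt n)) := by
  refine ⟨fun n hn V _ G W₄ _ H₄ Wₖ _ Hₖ hV hG h₄ hH₄ hₖ hHₖ => ?_, fun hk => ?_⟩
  · exact ProductMinors.isMinorUniversal_product hn G H₄ Hₖ hV hG h₄ hH₄ hₖ hHₖ
  · exact ProductMinors.not_isMinorUniversal_boxPi hk
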